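/- Let $E$ be a real Banach space with norm $\|\cdot\|_E$, continuously embedded in a real Hilbert space $H$ with inner product $(\cdot,\cdot)_H$. Fix $m>0$ and let $M=\{u\in E : (u,u)_H=m\}$, with the topology inherited from $E$, and $T_uM=\{v\in E : (u,v)_H=0\}$ for $u\in M$. For $I\in C^1(E,\mathbb R)$ and $u\in M$ put $$\|I|_M'(u)\|=\sup\{|\langle I'(u),v\rangle| : v\in T_uM,\ \|v\|_E\le 1\}.$$ A point $u\in M$ is a critical point of $I|_M$ if $\langle I'(u),v\rangle=0$ for all $v\in T_uM$; let $K^c$ be the set of critical points $u$ of $I|_M$ with $I(u)=c$, and call $c\in\mathbb R$ a critical value of $I|_M$ if $K^c\ne\emptyset$. $I|_M$ satisfies $(PS)_c$ if every sequence $(u_n)$ in $M$ with $I(u_n)\to c$ and $\|I|_M'(u_n)\|\to0$ has a subsequence converging in $M$. For a closed symmetric set $A\subset M$, the genus $\mathcal G(A)$ is $0$ if $A=\emptyset$, and otherwise the least integer $k\ge1$ for which there is an odd continuous map $A\to\mathbb R^k\setminus\{0\}$, with $\mathcal G(A)=\infty$ if no such $k$ exists. For $k\ge 1$ let $\Gamma_k$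 be the family of closed symmetric $A\subset M$ with $\mathcal G(A)\ge k$. **Theorem.** Let $I:E\to\mathbb R$ be even and of class $C^1$. Assume that $I|_M$ is bounded from below and satisfies $(PS)_c$ for all $c<0$, and that $\Gamma_k\neq\emptyset$ for every $k\ge1$. Then the minimax values $$c_k:=\inf_{A\in\Gamma_k}\sup_{u\in A}I(u),\qquad k\ge1,$$ are real numbers with $-\infty<c_1\le c_2\le\cdots\le c_k\le\cdots$, and the following hold. (i) If $c_k<0$, then $c_k$ is a critical value of $I|_M$. (ii) If $c_k=c_{k+1}=\cdots=c_{k+l-1}=:c<0$ for some $k,l\ge1$, then $\mathcal G(K^c)\ge l$. In particular, if $l\ge2$, then $I|_M$ has infinitely many critical points at the level $c$. (iii) If $c_k<0$ for all $k\ge1$, then $c_k\to0^-$ as $k\to\infty$. -/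

import Mathlib

open Filter Topology

noncomputable section

namespace ConstrainedMinimax

/-- There is an odd continuous mapping from `A` to `ℝ^k` without the origin. (Only the values
of `φ` on `A` matter; `A` is meant to be symmetric.) -/
def HasOddMap {E : Type*} [TopologicalSpace E] [Neg E] (A : Set E) (k : ℕ) : Prop :=
  ∃ φ : E → EuclideanSpace ℝ (Fin k),
    ContinuousOn φ A ∧ (∀ u ∈ A, φ (-u) = -φ u) ∧ ∀ u ∈ A, φ u ≠ 0

open Classical in
/-- The genus of a symmetric set `A`: `0` if `A` is empty, otherwise the least `k ≥ 1` for which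
there is an odd continuous mapping from `A` to `ℝ^k` without the origin, and `∞` if there is no
such `k` (the infimum of the empty set in `ℕ∞` is `⊤`). -/
def genus {E : Type*} [TopologicalSpace E] [Neg E] (A : Set E) : ℕ∞ :=
  if A = ∅ then 0 else ⨅ (k : ℕ) (_ : 1 ≤ k ∧ HasOddMap A k), (k : ℕ∞)

variable {E H : Type*} [NormedAddCommGroup E] [NormedSpace ℝ E]
  [NormedAddCommGroup H] [InnerProductSpace ℝ H]

/-- The manifold `{u ∈ E | (u, u)_H = m}`, for `E` embedded in `H` through `J`. -/
def sphere (J : E →L[ℝ] H) (m : ℝ) : Set E :=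
  {u | inner ℝ (J u) (J u) = m}

/-- The tangent space `{v ∈ E | (u, v)_H = 0}` of the manifold at `u`. -/
def tangent (J : E →L[ℝ] H) (u : E) : Set E :=
  {v | inner ℝ (J u) (J v) = 0}

/-- The norm of the derivative of the restricted functional at `u`: the supremum of `|⟨I'(u), v⟩|`
over the tangent vectors `v` at `u` with `‖v‖ ≤ 1` (a nonempty set of reals, bounded by the
operator norm of `I'(u)`). -/
def derivNorm (J : E →L[ℝ] H) (I : E → ℝ) (u : E) : ℝ :=
  sSup ((fun v : E => |fderiv ℝ I u v|) '' {v | ‖v‖ ≤ 1 ∧ v ∈ tangent J u})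

/-- `u` is a critical point of the restriction of `I` to the manifold. -/
def IsCriticalPoint (J : E →L[ℝ] H) (m : ℝ) (I : E → ℝ) (u : E) : Prop :=
  u ∈ sphere J m ∧ ∀ v ∈ tangent J u, fderiv ℝ I u v = 0

/-- The set `K^c` of critical points of the restricted functional at the level `c`. -/
def criticalSet (J : E →L[ℝ] H) (m : ℝ) (I : E → ℝ) (c : ℝ) : Set E :=
  {u | IsCriticalPoint J m I u ∧ I u = c}

/-- `c` is a critical value of the restricted functional. -/
def IsCriticalValue (J : E →L[ℝ] H) (m : ℝ) (I : E → ℝ) (c : ℝ) : Prop :=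
  ∃ u, IsCriticalPoint J m I u ∧ I u = c

/-- The Palais-Smale condition of the restricted functional at the level `c`; convergence is
in the norm of `E`. -/
def PalaisSmale (J : E →L[ℝ] H) (m : ℝ) (I : E → ℝ) (c : ℝ) : Prop :=
  ∀ u : ℕ → E, (∀ n, u n ∈ sphere J m) →
    Tendsto (fun n => I (u n)) atTop (𝓝 c) →
    Tendsto (fun n => derivNorm J I (u n)) atTop (𝓝 0) →
    ∃ v ∈ sphere J m, ∃ s : ℕ → ℕ, StrictMono s ∧ Tendsto (fun n => u (s n)) atTop (𝓝 v)

/-- The family of closed symmetric subsets of the manifold (which is itself closed in `E`, so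
that being closed in it and in `E` agree). -/
def symmSets (J : E →L[ℝ] H) (m : ℝ) : Set (Set E) :=
  {A | A ⊆ sphere J m ∧ IsClosed A ∧ ∀ u ∈ A, -u ∈ A}

/-- The family `Γ_k` of closed symmetric subsets of the manifold of genus at least `k`. -/
def Gam (J : E →L[ℝ] H) (m : ℝ) (k : ℕ) : Set (Set E) :=
  {A | A ∈ symmSets J m ∧ (k : ℕ∞) ≤ genus A}

/-- The minimax value: the infimum over `A ∈ Γ_k` of the supremum of `I` over `A`, computed in
the extended reals. -/
def minimax (J : E →L[ℝ] H) (m : ℝ) (I : E → ℝ) (k : ℕ) : EReal :=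
  ⨅ A ∈ Gam J m k, ⨆ u ∈ A, (I u : EReal)

end ConstrainedMinimax

end

/-! Everything rests on one inequality (`exists_sublevel_genus`): if (PS) holds at `c`, then for
some `ε > 0` the genus of `{I ≤ c + ε}` in the sphere is at most that of `{I ≤ c - ε}` plus any
finite bound on the genus of `K^c`. Since `c_{j+1}` can be read off the genus of sublevels,
`c_{j+q+1} ≤ a` then forces `c_{j+1} ≤ a - ε`, where `q` bounds the genus of `K^a` and `ε` does not
depend on `j`. This gives (ii), and (i) is its case `l = 1`. For (iii), `K^a` is compact, hence of
finite genus, so a negative supremum `a` of the `c_k` would satisfy `a ≤ a - ε`.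

The deformation uses no flow. A tangential step followed by radial retraction moves each point by at
most a constant times the decrease of `I`. Orbits that stay above `c - ε` are therefore Cauchy, and
their limit would be a fixed point where the step is strictly decreasing. The number of steps is
made continuous by allowing fractional ones (`exists_odd_deformation`).

Members of `Γ_k` need not have `I` bounded above. Finiteness of `c_k` comes from
`HasOddMap.of_sublevels`: a uniform genus bound for the sublevels would bound the genus of the whole
sphere. -/

namespace ConstrainedMinimax

/-! ### Elementary properties of the genus -/

section Genus

variable {X : Type*} [TopologicalSpace X] [Neg X] {A B : Set X} {k l : ℕ}

theorem HasOddMap.of_finrank {V : Type*} [NormedAddCommGroup V] [NormedSpace ℝ V]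
    [FiniteDimensional ℝ V] (hV : Module.finrank ℝ V = k) {φ : X → V} (hc : ContinuousOn φ A)
    (ho : ∀ u ∈ A, φ (-u) = -φ u) (h0 : ∀ u ∈ A, φ u ≠ 0) : HasOddMap A k := by
  let e : V ≃L[ℝ] EuclideanSpace ℝ (Fin k) := ContinuousLinearEquiv.ofFinrankEq (by simp [hV])
  refine ⟨fun u => e (φ u), e.continuous.comp_continuousOn hc, fun u hu => ?_, fun u hu => ?_⟩
  · simp [ho u hu]
  · simpa using h0 u hu

theorem HasOddMap.mono_set (h : HasOddMap B k) (hAB : A ⊆ B) : HasOddMap A k := by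
  obtain ⟨φ, hc, ho, h0⟩ := h
  exact ⟨φ, hc.mono hAB, fun u hu => ho u (hAB hu), fun u hu => h0 u (hAB hu)⟩

theorem HasOddMap.mono (h : HasOddMap A k) (hkl : k ≤ l) : HasOddMap A l := by
  obtain ⟨φ, hc, ho, h0⟩ := h
  refine HasOddMap.of_finrank (V := EuclideanSpace ℝ (Fin k) × EuclideanSpace ℝ (Fin (l - k)))
    (by simp; omega) (φ := fun u => (φ u, 0)) (by fun_prop) (fun u hu => ?_) (fun u hu => ?_)
  · simp [ho u hu]
  · simpa using h0 u hu

theorem HasOddMap.comp {Y : Type*} [TopologicalSpace Y] [Neg Y] {C : Set Y} {η : X → Y}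
    (h : HasOddMap C k) (hη : ContinuousOn η A) (ho : ∀ u ∈ A, η (-u) = -η u)
    (hm : Set.MapsTo η A C) : HasOddMap A k := by
  obtain ⟨φ, hc, hφ, h0⟩ := h
  exact ⟨φ ∘ η, hc.comp hη hm, fun u hu => by simp [ho u hu, hφ _ (hm hu)],
    fun u hu => h0 _ (hm hu)⟩

theorem hasOddMap_zero_iff : HasOddMap A 0 ↔ A = ∅ := by
  constructor
  · rintro ⟨φ, -, -, h0⟩
    exact Set.eq_empty_of_forall_notMem fun u hu => h0 u hu (Subsingleton.elim _ _)
  · rintro rfl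
    exact ⟨0, by simp, by simp, by simp⟩

/-- Odd maps into a small space embed in larger ones, and the target `ℝ^0` admits only the empty
set, so the case split in `genus` disappears. -/
theorem genus_le_iff : genus A ≤ k ↔ HasOddMap A k := by
  unfold genus
  split_ifs with hA
  · simpa using (hasOddMap_zero_iff.2 hA).mono (Nat.zero_le k)
  · constructor
    · intro h
      have hlt : (⨅ (j : ℕ) (_ : 1 ≤ j ∧ HasOddMap A j), (j : ℕ∞)) < ((k + 1 : ℕ) : ℕ∞) :=
        lt_of_le_of_lt h (by exact_mod_cast Nat.lt_succ_self k)
      simp only [iInf_lt_iff] at hlt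
      obtain ⟨j, hj, hjk⟩ := hlt
      exact hj.2.mono (Nat.lt_succ_iff.1 (by exact_mod_cast hjk))
    · intro h
      refine iInf₂_le k ⟨Nat.one_le_iff_ne_zero.2 ?_, h⟩
      rintro rfl
      exact hA (hasOddMap_zero_iff.1 h)

theorem succ_le_genus_iff : ((k + 1 : ℕ) : ℕ∞) ≤ genus A ↔ ¬ HasOddMap A k := by
  rw [← genus_le_iff, not_le]
  push_cast
  exact ENat.add_one_le_iff (ENat.natCast_ne_top k)

end Genus

/-! ### Genus of subsets of a normed space -/

section NormedSpaceGenus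

variable {E : Type*} [NormedAddCommGroup E] {A B K : Set E} {k l : ℕ}

/-- Tietze extension followed by taking the odd part, which changes nothing on the symmetric set
`A`. -/
theorem HasOddMap.exists_continuous (h : HasOddMap A k) (hA : IsClosed A)
    (hs : ∀ u ∈ A, -u ∈ A) : ∃ φ : E → EuclideanSpace ℝ (Fin k),
      Continuous φ ∧ (∀ u, φ (-u) = -φ u) ∧ ∀ u ∈ A, φ u ≠ 0 := by
  obtain ⟨φ, hc, ho, h0⟩ := h
  obtain ⟨Φ, hΦ⟩ := ContinuousMap.exists_restrict_eq hA
    (⟨A.domRestrict φ, hc.domRestrict⟩ : C(A, EuclideanSpace ℝ (Fin k)))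
  have hΦA : ∀ u ∈ A, Φ u = φ u := fun u hu => congrArg (fun f => f ⟨u, hu⟩) hΦ
  refine ⟨fun u => (1 / 2 : ℝ) • (Φ u - Φ (-u)), by fun_prop, fun u => ?_, fun u hu => ?_⟩
  · simp only [neg_neg, ← smul_neg, neg_sub]
  · simp only [hΦA u hu, hΦA _ (hs u hu), ho u hu, sub_neg_eq_add, ← two_smul ℝ, smul_smul]
    simpa using h0 u hu

theorem HasOddMap.union (hA : IsClosed A) (hsA : ∀ u ∈ A, -u ∈ A) (hB : IsClosed B)
    (hsB : ∀ u ∈ B, -u ∈ B) (h : HasOddMap A k) (h' : HasOddMap B l) :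
    HasOddMap (A ∪ B) (k + l) := by
  obtain ⟨φ, hc, ho, h0⟩ := h.exists_continuous hA hsA
  obtain ⟨ψ, hc', ho', h0'⟩ := h'.exists_continuous hB hsB
  refine HasOddMap.of_finrank (V := EuclideanSpace ℝ (Fin k) × EuclideanSpace ℝ (Fin l))
    (by simp) (φ := fun u => (φ u, ψ u)) (by fun_prop) (fun u _ => ?_) (fun u hu => ?_)
  · simp [ho, ho']
  · rcases hu with hu | hu
    · simp [h0 u hu]
    · simp [h0' u hu]

theorem HasOddMap.exists_cthickening (h : HasOddMap K k) (hK : IsCompact K)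
    (hs : ∀ u ∈ K, -u ∈ K) : ∃ δ > 0, HasOddMap (Metric.cthickening δ K) k := by
  obtain ⟨φ, hc, ho, h0⟩ := h.exists_continuous hK.isClosed hs
  obtain ⟨δ, hδ, hsub⟩ := hK.exists_cthickening_subset_open
    (isOpen_ne_fun hc continuous_const : IsOpen {u | φ u ≠ 0}) h0
  exact ⟨δ, hδ, φ, hc.continuousOn, fun u _ => ho u, hsub⟩

/-- A well-ordering picks one point of each antipodal pair to receive the sign `1`; continuity is
automatic on a finite set. -/
theorem hasOddMap_one_of_finite [NormedSpace ℝ E] (hK : K.Finite) (h0 : 0 ∉ K) :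
    HasOddMap K 1 := by
  classical
  let φ : E → ℝ := fun u => if WellOrderingRel u (-u) then 1 else -1
  refine HasOddMap.of_finrank (V := ℝ) (by simp) (φ := φ) ?_ (fun u hu => ?_) (fun u _ => ?_)
  · exact hK.continuousOn _
  · have hne : u ≠ -u := by
      intro h
      have h2 : (2 : ℝ) • u = 0 := by
        rw [two_smul]
        exact eq_neg_iff_add_eq_zero.1 h
      exact h0 ((smul_eq_zero_iff_right two_ne_zero).1 h2 ▸ hu)
    simp only [φ, neg_neg]
    rcases trichotomous_of WellOrderingRel u (-u) with h | h | h
    · simp [h, asymm_of WellOrderingRel h]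
    · exact absurd h hne
    · simp [h, asymm_of WellOrderingRel h]
  · simp only [φ]
    split_ifs <;> simp

theorem neg_mem_cthickening {δ : ℝ} (hs : ∀ u ∈ K, -u ∈ K) {u : E}
    (hu : u ∈ Metric.cthickening δ K) : -u ∈ Metric.cthickening δ K := by
  have hK : -K = K := Set.Subset.antisymm (fun x hx => by simpa using hs _ hx) hs
  rw [Metric.mem_cthickening_iff] at hu ⊢
  rwa [← hK, infEDist_neg_neg]

/-- If `|x - round x| < 1 / 2`, then `round` is constant near `x`. -/
theorem eventually_round_eq {x : ℝ} (hx : |x - round x| < 1 / 2) :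
    ∀ᶠ y in 𝓝 x, round y = round x := by
  have : ∀ᶠ y in 𝓝 x, |y - (round x : ℝ)| < 1 / 2 :=
    (by fun_prop : Continuous fun y : ℝ => |y - (round x : ℝ)|).continuousAt.eventually_lt
      continuousAt_const hx
  filter_upwards [this] with y hy
  rw [abs_lt] at hy
  rw [round_eq y, Int.floor_eq_iff]
  constructor <;> linarith

theorem isClosed_abs_sub_round_le {X : Type*} [TopologicalSpace X] {f : X → ℝ}
    (hf : Continuous f) (r : ℝ) : IsClosed {u | |f u - round (f u)| ≤ r} := by
  simp_rw [← UnitAddCircle.norm_eq]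
  exact isClosed_le ((AddCircle.continuous_mk' _).comp hf).norm continuous_const

/-- Away from half-integer values of `f`, `round (f u)` is locally constant, so the odd maps of
different sublevels can be used side by side on separate slabs. -/
theorem HasOddMap.of_sublevels_round {S : Set E} {f : E → ℝ} (hf : Continuous f)
    (he : ∀ u, f (-u) = f u) (h : ∀ r : ℝ, HasOddMap (S ∩ {u | f u ≤ r}) k) :
    HasOddMap (S ∩ {u | |f u - round (f u)| ≤ 1 / 4}) k := by
  choose φ hc ho h0 using h
  have hmem : ∀ u ∈ S ∩ {u | |f u - round (f u)| ≤ 1 / 4}, ∀ n : ℤ, round (f u) = n →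
      u ∈ S ∩ {u | f u ≤ n + 1} := by
    rintro u ⟨hu, hu'⟩ n rfl
    refine ⟨hu, ?_⟩
    simp only [Set.mem_ofPred_eq] at hu' ⊢
    have := (abs_le.1 hu').2
    linarith
  refine ⟨fun u => φ (round (f u) + 1) u, fun u hu => ?_, fun u hu => ?_, fun u hu => ?_⟩
  · have hev := hf.continuousAt.eventually
      (eventually_round_eq (lt_of_le_of_lt hu.2 (by norm_num : (1 / 4 : ℝ) < 1 / 2)))
    have hev' := eventually_nhdsWithin_of_eventually_nhds
      (s := S ∩ {u | |f u - round (f u)| ≤ 1 / 4}) hev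
    have hcu := hc (round (f u) + 1) u (hmem u hu _ rfl)
    refine Tendsto.congr' (f₁ := φ (round (f u) + 1)) ?_ (hcu.mono_left ?_)
    · filter_upwards [hev'] with v hv
      rw [hv]
    · refine le_inf inf_le_left (le_principal_iff.2 ?_)
      filter_upwards [hev', self_mem_nhdsWithin] with v hv hv'
      exact hmem v hv' _ hv
  · simp only [he]
    exact ho _ u (hmem u hu _ rfl)
  · exact h0 _ u (hmem u hu _ rfl)

/-- The genus of a closed symmetric set is at most twice the supremum of the genera of its
intersections with the sublevels of an even continuous function. -/
theorem HasOddMap.of_sublevels {S : Set E} (hS : IsClosed S) (hs : ∀ u ∈ S, -u ∈ S) {f : E → ℝ}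
    (hf : Continuous f) (he : ∀ u, f (-u) = f u)
    (h : ∀ r : ℝ, HasOddMap (S ∩ {u | f u ≤ r}) k) : HasOddMap S (k + k) := by
  have h1 := HasOddMap.of_sublevels_round hf he h
  -- A value farther than `1/4` from the integers is within `1/4` of them after a shift by `1/2`, so
  -- two families of slabs cover `S`.
  have hf' : Continuous fun u => f u + 1 / 2 := by fun_prop
  have h2 := HasOddMap.of_sublevels_round (S := S) (k := k) hf' (by simp [he])
    fun r => (h (r - 1 / 2)).mono_set fun u hu => ⟨hu.1, by
      have := hu.2
      simp only [Set.mem_ofPred_eq] at this ⊢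
      linarith⟩
  refine (HasOddMap.union (hS.inter (isClosed_abs_sub_round_le hf _)) (fun u hu => ?_)
    (hS.inter (isClosed_abs_sub_round_le hf' _)) (fun u hu => ?_) h1 h2).mono_set fun u hu => ?_
  · exact ⟨hs u hu.1, by simpa [he] using hu.2⟩
  · exact ⟨hs u hu.1, by simpa [he] using hu.2⟩
  · rw [← Set.inter_union_distrib_left]
    refine ⟨hu, ?_⟩
    by_cases hq : |f u - round (f u)| ≤ 1 / 4
    · exact Or.inl hq
    · right
      have hle := abs_sub_round (f u)
      push Not at hq
      simp only [Set.mem_ofPred_eq]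
      rcases le_total (round (f u) : ℝ) (f u) with hn | hn
      · rw [abs_of_nonneg (by linarith)] at hq hle
        refine (round_le _ (round (f u) + 1)).trans ?_
        rw [abs_le]; push_cast
        constructor <;> linarith
      · rw [abs_of_nonpos (by linarith)] at hq hle
        refine (round_le _ (round (f u))).trans ?_
        rw [abs_le]
        constructor <;> linarith

end NormedSpaceGenus

/-! ### Derivatives of even functionals and first order expansions -/

theorem fderiv_neg_of_even {E : Type*} [NormedAddCommGroup E] [NormedSpace ℝ E] {I : E → ℝ}
    (hI : Function.Even I) (u : E) : fderiv ℝ I (-u) = -fderiv ℝ I u := by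
  have h := (ContinuousLinearEquiv.neg ℝ (M := E)).comp_right_fderiv (f := I) (x := u)
  have h' : I ∘ (ContinuousLinearEquiv.neg ℝ (M := E)) = I := funext hI
  rw [h'] at h
  ext v
  simp [h]

/-- Uniform first order expansion of a strictly differentiable map along a continuous vector
field. -/
theorem HasStrictFDerivAt.exists_forall_norm_sub_smul_le {E F : Type*}
    [NormedAddCommGroup E] [NormedSpace ℝ E] [NormedAddCommGroup F] [NormedSpace ℝ F]
    {f : E → F} {L : E →L[ℝ] F} {u : E} (hf : HasStrictFDerivAt f L u) {w : E → E}
    (hw : ContinuousAt w u) {ε : ℝ} (hε : 0 < ε) :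
    ∃ t > 0, ∀ᶠ y in 𝓝 u, ∀ s, 0 ≤ s → s ≤ t →
      ‖f (y - s • w y) - f y + s • L (w u)‖ ≤ ε * s := by
  -- Half of `ε` pays for the differentiability error, where `‖w y‖ < ‖w u‖ + 1`, and half for
  -- replacing `w y` by `w u`.
  set c : ℝ := ε / 2 / (‖w u‖ + 1) with hc
  have hc0 : 0 < c := by positivity
  have hT : Tendsto (fun p : E × ℝ => (p.1 - p.2 • w p.1, p.1)) (𝓝 u ×ˢ 𝓝 0)
      (𝓝 (u, u)) := by
    have h1 : Tendsto (fun p : E × ℝ => p.1) (𝓝 u ×ˢ 𝓝 0) (𝓝 u) := tendsto_fst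
    have h2 : Tendsto (fun p : E × ℝ => p.1 - p.2 • w p.1) (𝓝 u ×ˢ 𝓝 0)
        (𝓝 (u - (0 : ℝ) • w u)) := h1.sub (tendsto_snd.smul (hw.tendsto.comp h1))
    rw [zero_smul, sub_zero] at h2
    rw [nhds_prod_eq]
    exact h2.prodMk h1
  have h1 := hT.eventually ((Asymptotics.isLittleO_iff.1 hf.isLittleO) hc0)
  obtain ⟨p, hp, q, hq, hpq⟩ := eventually_prod_iff.1 h1
  obtain ⟨t, ht, htq⟩ := Metric.eventually_nhds_iff.1 hq
  have h2 : ∀ᶠ y in 𝓝 u, ‖w y‖ < ‖w u‖ + 1 :=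
    hw.norm.eventually_lt continuousAt_const (by simp)
  have h3 : ∀ᶠ y in 𝓝 u, ‖L (w u - w y)‖ < ε / 2 := by
    have : ContinuousAt (fun y => ‖L (w u - w y)‖) u :=
      (L.continuous.continuousAt.comp (continuousAt_const.sub hw)).norm
    exact this.eventually_lt continuousAt_const (by simpa using hε)
  refine ⟨t / 2, by positivity, ?_⟩
  filter_upwards [hp, h2, h3] with y hy hy2 hy3 s hs hst
  have hs' : q s := htq (by rw [Real.dist_eq, sub_zero, abs_of_nonneg hs]; linarith)
  have h4 := hpq hy hs'
  simp only [sub_sub_cancel_left, norm_neg, norm_smul, Real.norm_of_nonneg hs, map_neg,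
    map_smul] at h4
  have h5 : f (y - s • w y) - f y + s • L (w u) =
      (f (y - s • w y) - f y - -(s • L (w y))) + s • L (w u - w y) := by
    rw [map_sub, smul_sub]; abel
  rw [h5]
  refine (norm_add_le _ _).trans ?_
  rw [norm_smul, Real.norm_of_nonneg hs]
  have h6 : c * (s * ‖w y‖) ≤ ε / 2 * s := by
    calc c * (s * ‖w y‖) ≤ c * (s * (‖w u‖ + 1)) := by gcongr
      _ = ε / 2 * s := by rw [hc]; field_simp
  nlinarith [mul_le_mul_of_nonneg_left hy3.le hs]

/-! ### Tangent projection and radial retraction -/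

section Retraction

variable {E H : Type*} [NormedAddCommGroup E] [NormedSpace ℝ E]
  [NormedAddCommGroup H] [InnerProductSpace ℝ H] {J : E →L[ℝ] H} {m : ℝ} {u v : E}

theorem isClosed_sphere : IsClosed (sphere J m) :=
  isClosed_eq (by fun_prop) continuous_const

theorem neg_mem_sphere (hu : u ∈ sphere J m) : -u ∈ sphere J m := by
  simpa [sphere] using hu

theorem zero_notMem_sphere (hm : 0 < m) : (0 : E) ∉ sphere J m := by
  simp [sphere, hm.ne]

/-- The projection onto the tangent space at `u`. -/
noncomputable def tangentProj (J : E →L[ℝ] H) (m : ℝ) (u v : E) : E :=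
  v - (inner ℝ (J u) (J v) / m) • u

theorem tangentProj_mem (hm : 0 < m) (hu : u ∈ sphere J m) : tangentProj J m u v ∈ tangent J u := by
  have hu : inner ℝ (J u) (J u) = m := hu
  simp only [tangentProj, tangent, Set.mem_ofPred_eq, map_sub, map_smul, inner_sub_right,
    inner_smul_right, hu]
  field_simp
  ring

theorem tangentProj_eq_self (hv : v ∈ tangent J u) : tangentProj J m u v = v := by
  have hv : inner ℝ (J u) (J v) = 0 := hv
  simp [tangentProj, hv]

theorem tangentProj_neg_left : tangentProj J m (-u) v = tangentProj J m u v := by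
  simp [tangentProj, neg_div]

theorem tangentProj_add (v v' : E) :
    tangentProj J m u (v + v') = tangentProj J m u v + tangentProj J m u v' := by
  simp only [tangentProj, map_add, inner_add_right, add_div, add_smul]
  abel

theorem tangentProj_smul (a : ℝ) (v : E) :
    tangentProj J m u (a • v) = a • tangentProj J m u v := by
  simp only [tangentProj, map_smul, inner_smul_right, mul_div_assoc, smul_sub, smul_smul]

theorem continuous_tangentProj : Continuous fun p : E × E => tangentProj J m p.1 p.2 := by
  unfold tangentProj
  fun_prop

/-- The radial retraction onto the sphere. -/
noncomputable def retr (J : E →L[ℝ] H) (m : ℝ) (u : E) : E :=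
  √(m / inner ℝ (J u) (J u)) • u

theorem retr_mem (hm : 0 < m) (hu : 0 < inner ℝ (J u) (J u)) : retr J m u ∈ sphere J m := by
  simp only [retr, sphere, Set.mem_ofPred_eq, map_smul, inner_smul_left, inner_smul_right]
  simp only [conj_trivial, ← mul_assoc]
  rw [Real.mul_self_sqrt (by positivity)]
  field_simp

theorem retr_eq_self (hm : 0 < m) (hu : u ∈ sphere J m) : retr J m u = u := by
  have hu : inner ℝ (J u) (J u) = m := hu
  rw [retr, hu, div_self hm.ne', Real.sqrt_one, one_smul]

theorem retr_neg : retr J m (-u) = -retr J m u := by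
  simp [retr]

/-- By Pythagoras a tangential step never goes inside the sphere, so the retraction is defined after
a step of any length. -/
theorem le_inner_sub_smul (hu : u ∈ sphere J m) (hv : v ∈ tangent J u) (s : ℝ) :
    m ≤ inner ℝ (J (u - s • v)) (J (u - s • v)) := by
  have hu : inner ℝ (J u) (J u) = m := hu
  have hv : inner ℝ (J u) (J v) = 0 := hv
  have hv' : inner ℝ (J v) (J u) = 0 := by rw [real_inner_comm, hv]
  have h0 : 0 ≤ inner ℝ (J v) (J v) := real_inner_self_nonneg
  simp only [map_sub, map_smul, inner_sub_left, inner_sub_right, inner_smul_left,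
    inner_smul_right, hu, hv, hv', conj_trivial]
  nlinarith [mul_nonneg (mul_self_nonneg s) h0]

theorem continuousOn_retr : ContinuousOn (retr J m) {u | inner ℝ (J u) (J u) ≠ 0} := by
  unfold retr
  refine ContinuousOn.smul ?_ continuousOn_id
  refine Real.continuous_sqrt.comp_continuousOn (ContinuousOn.div continuousOn_const ?_ fun u hu => hu)
  fun_prop

theorem hasStrictFDerivAt_retr (hm : 0 < m) (hu : u ∈ sphere J m) :
    ∃ L : E →L[ℝ] E, HasStrictFDerivAt (retr J m) L u ∧ ∀ v ∈ tangent J u, L v = v := by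
  have hu' : inner ℝ (J u) (J u) = m := hu
  have hq : HasStrictFDerivAt (fun x => inner ℝ (J x) (J x)) _ u :=
    J.hasStrictFDerivAt.inner ℝ J.hasStrictFDerivAt
  have hd : ∃ d, HasStrictDerivAt (fun y : ℝ => √(m / y)) d (inner ℝ (J u) (J u)) := by
    rw [hu']
    exact ⟨_, (((hasStrictDerivAt_const m m).div (hasStrictDerivAt_id m) hm.ne').sqrt
      (by simp [hm.ne']))⟩
  obtain ⟨d, hd⟩ := hd
  have hL := (hd.comp_hasStrictFDerivAt u hq).smul (hasStrictFDerivAt_id u)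
  refine ⟨_, hL, fun v hv => ?_⟩
  have hv : inner ℝ (J u) (J v) = 0 := hv
  have hv' : inner ℝ (J v) (J u) = 0 := by rw [real_inner_comm, hv]
  have hn : ‖J u‖ = √m := by rw [norm_eq_sqrt_real_inner, hu']
  simp [hn, hv, hv', (Real.sqrt_pos.2 hm).ne']

end Retraction

/-! ### Constrained derivative and the Palais-Smale condition -/

section Derivative

variable {E H : Type*} [NormedAddCommGroup E] [NormedSpace ℝ E]
  [NormedAddCommGroup H] [InnerProductSpace ℝ H] {J : E →L[ℝ] H} {m : ℝ} {I : E → ℝ} {u v : E}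

theorem derivNorm_nonneg : 0 ≤ derivNorm J I u :=
  Real.sSup_nonneg (by rintro _ ⟨v, -, rfl⟩; exact abs_nonneg _)

theorem abs_fderiv_le_derivNorm (hv : v ∈ tangent J u) (h1 : ‖v‖ ≤ 1) :
    |fderiv ℝ I u v| ≤ derivNorm J I u := by
  refine le_csSup ⟨‖fderiv ℝ I u‖, ?_⟩ ⟨v, ⟨h1, hv⟩, rfl⟩
  rintro _ ⟨v, ⟨h1, -⟩, rfl⟩
  exact (fderiv ℝ I u).unit_le_opNorm v h1

theorem smul_mem_tangent (a : ℝ) (hv : v ∈ tangent J u) : a • v ∈ tangent J u := by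
  have hv : inner ℝ (J u) (J v) = 0 := hv
  simp [tangent, inner_smul_right, hv]

theorem abs_fderiv_le_derivNorm_mul (hv : v ∈ tangent J u) :
    |fderiv ℝ I u v| ≤ derivNorm J I u * ‖v‖ := by
  rcases eq_or_ne v 0 with rfl | h0
  · simp
  · have := abs_fderiv_le_derivNorm (I := I) (smul_mem_tangent ‖v‖⁻¹ hv)
      (by simp [norm_smul, h0])
    rw [map_smul, smul_eq_mul, abs_mul, abs_inv, abs_norm] at this
    rwa [inv_mul_le_iff₀ (norm_pos_iff.2 h0), mul_comm] at this

theorem exists_tangent_of_lt_derivNorm {σ : ℝ} (hσ : σ < derivNorm J I u) :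
    ∃ v ∈ tangent J u, ‖v‖ ≤ 1 ∧ σ < fderiv ℝ I u v := by
  obtain ⟨_, ⟨v, ⟨h1, hv⟩, rfl⟩, h⟩ := exists_lt_of_lt_csSup
    (⟨_, 0, by simp [tangent], rfl⟩ : (((fun v : E => |fderiv ℝ I u v|) ''
      {v | ‖v‖ ≤ 1 ∧ v ∈ tangent J u})).Nonempty) hσ
  rcases lt_abs.1 h with h | h
  · exact ⟨v, hv, h1, h⟩
  · refine ⟨-v, ?_, by simpa using h1, by simpa using h⟩
    simpa using smul_mem_tangent (-1) hv

theorem derivNorm_eq_zero (hu : IsCriticalPoint J m I u) : derivNorm J I u = 0 := by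
  by_contra hne
  obtain ⟨v, hv, -, h⟩ := exists_tangent_of_lt_derivNorm (lt_of_le_of_ne derivNorm_nonneg (Ne.symm hne))
  exact h.ne' (hu.2 v hv)

/-- A limit of points of the sphere along which the derivative tends to zero is critical. -/
theorem isCriticalPoint_of_tendsto (hm : 0 < m) (hI : ContDiff ℝ 1 I) {x : ℕ → E}
    (hx : ∀ n, x n ∈ sphere J m) (hxu : Tendsto x atTop (𝓝 u))
    (hd : Tendsto (fun n => derivNorm J I (x n)) atTop (𝓝 0)) : IsCriticalPoint J m I u := by
  refine ⟨isClosed_sphere.mem_of_tendsto hxu (Eventually.of_forall hx), fun v hv => ?_⟩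
  -- A vector tangent at `u` need not be tangent at `x n`; its projections are, and they converge
  -- back to it.
  have hP : Tendsto (fun n => tangentProj J m (x n) v) atTop (𝓝 v) := by
    have := ((continuous_tangentProj (J := J) (m := m)).tendsto (u, v)).comp
      (hxu.prodMk_nhds tendsto_const_nhds)
    simpa [Function.comp_def, tangentProj_eq_self hv] using this
  have h1 : Tendsto (fun n => |fderiv ℝ I (x n) (tangentProj J m (x n) v)|) atTop
      (𝓝 |fderiv ℝ I u v|) :=
    ((isBoundedBilinearMap_apply.continuous.tendsto (fderiv ℝ I u, v)).comp
      ((((hI.continuous_fderiv one_ne_zero).tendsto u).comp hxu).prodMk_nhds hP)).abs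
  have h2 : Tendsto (fun n => derivNorm J I (x n) * ‖tangentProj J m (x n) v‖) atTop
      (𝓝 (0 * ‖v‖)) := hd.mul hP.norm
  have := le_of_tendsto_of_tendsto' h1 h2
    fun n => abs_fderiv_le_derivNorm_mul (tangentProj_mem hm (hx n))
  rw [zero_mul] at this
  exact abs_nonpos_iff.1 this

/-- Every sequence of critical points at level `c` is itself a Palais-Smale sequence. -/
theorem isCompact_criticalSet (hm : 0 < m) (hI : ContDiff ℝ 1 I) {c : ℝ}
    (hPS : PalaisSmale J m I c) : IsCompact (criticalSet J m I c) := by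
  rw [isCompact_iff_isSeqCompact]
  intro x hx
  have hd : ∀ n, derivNorm J I (x n) = 0 := fun n => derivNorm_eq_zero (hx n).1
  obtain ⟨v, -, s, hs, hv⟩ := hPS x (fun n => (hx n).1.1)
    (tendsto_const_nhds.congr fun n => (hx n).2.symm) (by simp [hd])
  refine ⟨v, ⟨isCriticalPoint_of_tendsto hm hI (fun n => (hx (s n)).1.1) hv (by simp [hd]), ?_⟩,
    s, hs, hv⟩
  have := (hI.continuous.tendsto v).comp hv
  exact tendsto_nhds_unique this (tendsto_const_nhds.congr fun n => (hx (s n)).2.symm)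

theorem neg_mem_criticalSet (hE : Function.Even I) {c : ℝ} (hu : u ∈ criticalSet J m I c) :
    -u ∈ criticalSet J m I c := by
  refine ⟨⟨neg_mem_sphere hu.1.1, fun v hv => ?_⟩, (hE u).trans hu.2⟩
  rw [fderiv_neg_of_even hE, neg_apply, neg_eq_zero]
  exact hu.1.2 v (by simpa [tangent] using hv)

/-- Outside a neighbourhood of the critical set, the derivative is bounded away from zero near a
level at which the Palais-Smale condition holds. -/
theorem PalaisSmale.exists_lt_derivNorm (hm : 0 < m) (hI : ContDiff ℝ 1 I) {c : ℝ}
    (hPS : PalaisSmale J m I c) {U : Set E} (hU : IsOpen U) (hKU : criticalSet J m I c ⊆ U) :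
    ∃ σ > 0, ∀ u ∈ sphere J m, |I u - c| ≤ σ → u ∉ U → σ < derivNorm J I u := by
  by_contra! hcon
  have hpos : ∀ n : ℕ, (0 : ℝ) < 1 / (n + 1) := fun n => by positivity
  choose x hx hxc hxU hxd using fun n : ℕ => hcon (1 / (n + 1)) (hpos n)
  have h0 := tendsto_one_div_add_atTop_nhds_zero_nat (𝕜 := ℝ)
  have hd : Tendsto (fun n => derivNorm J I (x n)) atTop (𝓝 0) :=
    squeeze_zero (fun n => derivNorm_nonneg) hxd h0
  have hc : Tendsto (fun n => I (x n)) atTop (𝓝 c) := by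
    rw [tendsto_iff_norm_sub_tendsto_zero]
    exact squeeze_zero (fun n => norm_nonneg _) hxc h0
  obtain ⟨v, -, s, hs, hv⟩ := hPS x hx hc hd
  have hcrit := isCriticalPoint_of_tendsto hm hI (fun n => hx (s n)) hv (hd.comp hs.tendsto_atTop)
  have hIv := tendsto_nhds_unique ((hI.continuous.tendsto v).comp hv) (hc.comp hs.tendsto_atTop)
  have hvU : v ∈ Uᶜ := hU.isClosed_compl.mem_of_tendsto hv (Eventually.of_forall fun n => hxU (s n))
  exact hvU (hKU ⟨hcrit, hIv⟩)

end Derivative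

/-! ### One step of the descent -/

section Step

variable {E H : Type*} [NormedAddCommGroup E] [NormedSpace ℝ E]
  [NormedAddCommGroup H] [InnerProductSpace ℝ H] {J : E →L[ℝ] H} {m : ℝ} {I : E → ℝ}
  {Q : Set E} {σ : ℝ}

/-- A continuous odd tangent field of pseudo-gradient type. -/
theorem exists_tangent_field (hm : 0 < m) (hI : ContDiff ℝ 1 I) (hE : Function.Even I)
    (hQ : IsClosed Q) (hQs : ∀ u ∈ Q, -u ∈ Q)
    (hd : ∀ u ∈ Q, σ < derivNorm J I u) :
    ∃ w : E → E, Continuous w ∧ (∀ u, w (-u) = -w u) ∧ (∀ u ∈ sphere J m, w u ∈ tangent J u) ∧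
      ∀ u ∈ Q, ‖w u‖ < 2 ∧ σ < fderiv ℝ I u (w u) := by
  have hdc := hI.continuous_fderiv one_ne_zero
  -- The conditions are convex in `v`, so constant local choices can be patched; the bound `2`
  -- instead of `1` leaves room for the projection at nearby points.
  obtain ⟨v, hv⟩ := exists_continuous_forall_mem_convex_of_local_const
    (t := fun y : E => {v : E | y ∈ Q →
      ‖tangentProj J m y v‖ < 2 ∧ σ < fderiv ℝ I y (tangentProj J m y v)})
    (fun y => by
      intro v hv v' hv' a b ha hb hab hy
      obtain ⟨h1, h2⟩ := hv hy
      obtain ⟨h1', h2'⟩ := hv' hy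
      have hball := convex_ball (0 : E) 2 (mem_ball_zero_iff.2 h1) (mem_ball_zero_iff.2 h1')
        ha hb hab
      have hIoi := convex_Ioi (𝕜 := ℝ) σ h2 h2' ha hb hab
      rw [tangentProj_add, tangentProj_smul, tangentProj_smul]
      refine ⟨mem_ball_zero_iff.1 hball, ?_⟩
      rw [map_add, map_smul, map_smul]
      exact hIoi)
    (fun x => by
      by_cases hx : x ∈ Q
      · obtain ⟨v, hvx, hv1, hvσ⟩ := exists_tangent_of_lt_derivNorm (hd x hx)
        have hP : Continuous fun y => tangentProj J m y v :=
          (continuous_tangentProj (J := J) (m := m)).comp (by fun_prop : Continuous fun y : E => (y, v))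
        have hxv := tangentProj_eq_self (m := m) hvx
        refine ⟨v, ?_⟩
        filter_upwards [hP.norm.continuousAt.eventually_lt continuousAt_const
            (show ‖tangentProj J m x v‖ < 2 by rw [hxv]; linarith),
          continuousAt_const.eventually_lt (hdc.clm_apply hP).continuousAt
            (show σ < fderiv ℝ I x (tangentProj J m x v) by rwa [hxv])] with y h1 h2 _
        exact ⟨h1, h2⟩
      · refine ⟨0, ?_⟩
        filter_upwards [hQ.isOpen_compl.mem_nhds hx] with y hy hy'
        exact absurd hy' hy)
  have hv' : ∀ y ∈ Q,
      ‖tangentProj J m y (v y)‖ < 2 ∧ σ < fderiv ℝ I y (tangentProj J m y (v y)) :=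
    fun y hy => hv y hy
  -- The odd part keeps both bounds on `Q`, because the projection is even in its base point and
  -- `fderiv ℝ I` is odd.
  refine ⟨fun u => (1 / 2 : ℝ) • (tangentProj J m u (v u) - tangentProj J m u (v (-u))), ?_,
    fun u => ?_, fun u hu => ?_, fun u hu => ?_⟩
  · have hP := continuous_tangentProj (J := J) (m := m)
    exact ((hP.comp (continuous_id.prodMk v.continuous)).sub
      (hP.comp (continuous_id.prodMk (v.continuous.comp continuous_neg)))).const_smul _
  · simp only [tangentProj_neg_left, neg_neg, ← smul_neg, neg_sub]
  · have h1 := tangentProj_mem (v := v u) hm hu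
    have h2 := tangentProj_mem (v := v (-u)) hm hu
    simp only [tangent, Set.mem_ofPred_eq] at h1 h2 ⊢
    rw [map_smul, map_sub, inner_smul_right, inner_sub_right, h1, h2]
    simp
  · obtain ⟨h1, h2⟩ := hv' u hu
    obtain ⟨h3, h4⟩ := hv' (-u) (hQs u hu)
    rw [tangentProj_neg_left] at h3 h4
    rw [fderiv_neg_of_even hE, neg_apply] at h4
    constructor
    · rw [norm_smul, Real.norm_of_nonneg (by norm_num)]
      linarith [norm_sub_le (tangentProj J m u (v u)) (tangentProj J m u (v (-u)))]
    · rw [map_smul, map_sub, smul_eq_mul]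
      linarith

/-- One step of the descent: an odd homotopy of the sphere which decreases `I` in proportion to
the displacement, and strictly on `Q`. -/
theorem exists_descent_step (hm : 0 < m) (hI : ContDiff ℝ 1 I) (hE : Function.Even I)
    (hQ : IsClosed Q) (hQM : Q ⊆ sphere J m) (hQs : ∀ u ∈ Q, -u ∈ Q) (hσ : 0 < σ)
    (hd : ∀ u ∈ Q, σ < derivNorm J I u) :
    ∃ g : ℝ → E → E,
      ContinuousOn (fun p : ℝ × E => g p.1 p.2) (Set.univ ×ˢ sphere J m) ∧
      (∀ s u, g s (-u) = -g s u) ∧ (∀ s, Set.MapsTo (g s) (sphere J m) (sphere J m)) ∧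
      (∀ u ∈ sphere J m, g 0 u = u) ∧
      (∀ s ∈ Set.Icc (0 : ℝ) 1, ∀ u ∈ sphere J m, ‖g s u - u‖ ≤ 3 / σ * (I u - I (g s u))) ∧
      ∀ u ∈ Q, I (g 1 u) < I u := by
  obtain ⟨w, hwc, hwo, hwt, hwQ⟩ := exists_tangent_field hm hI hE hQ hQs hd
  -- Choice of a continuous step length. Demanding the estimates for every `s ≤ r` makes the
  -- admissible `r` an interval, hence convex. The factor `3` is `‖w x‖ < 2` plus an expansion error
  -- of `1`.
  obtain ⟨τ, hτ⟩ := exists_continuous_forall_mem_convex_of_local_const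
    (t := fun y : E => {r : ℝ | 0 ≤ r ∧ (y ∈ Q → 0 < r) ∧ (y ∈ sphere J m → ∀ s, 0 ≤ s → s ≤ r →
      ‖retr J m (y - s • w y) - y‖ ≤ 3 * s ∧ I (retr J m (y - s • w y)) ≤ I y - σ * s)})
    (fun y => by
      refine Set.OrdConnected.convex ⟨fun a ha b hb r hr => ⟨ha.1.trans hr.1,
        fun hy => (ha.2.1 hy).trans_le hr.1, fun hy s hs hsr => hb.2.2 hy s hs (hsr.trans hr.2)⟩⟩)
    (fun x => by
      by_cases hx : x ∈ Q
      · obtain ⟨L, hL, hLt⟩ := hasStrictFDerivAt_retr hm (hQM hx)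
        have hwx := hwt x (hQM hx)
        have hLw := hLt _ hwx
        obtain ⟨hw2, hwσ⟩ := hwQ x hx
        have hIx : HasStrictFDerivAt I (fderiv ℝ I x) (retr J m x) := by
          rw [retr_eq_self hm (hQM hx)]
          exact hI.contDiffAt.hasStrictFDerivAt one_ne_zero
        obtain ⟨t, ht, h1⟩ := HasStrictFDerivAt.exists_forall_norm_sub_smul_le hL
          hwc.continuousAt one_pos
        obtain ⟨t', ht', h2⟩ := HasStrictFDerivAt.exists_forall_norm_sub_smul_le (hIx.comp x hL)
          hwc.continuousAt (sub_pos.2 hwσ)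
        refine ⟨min t t', ?_⟩
        filter_upwards [h1, h2] with y h1 h2
        refine ⟨(lt_min ht ht').le, fun _ => lt_min ht ht', fun hy s hs hst => ?_⟩
        have h1 := h1 s hs (hst.trans (min_le_left _ _))
        have h2 := h2 s hs (hst.trans (min_le_right _ _))
        rw [hLw, retr_eq_self hm hy] at h1
        simp only [ContinuousLinearMap.comp_apply, hLw,
          retr_eq_self hm hy, smul_eq_mul] at h2
        constructor
        · have h3 := norm_sub_le (retr J m (y - s • w y) - y + s • w x) (s • w x)
          rw [add_sub_cancel_right, norm_smul, Real.norm_of_nonneg hs] at h3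
          nlinarith
        · have := (abs_le.1 h2).2
          nlinarith
      · refine ⟨0, ?_⟩
        filter_upwards [hQ.isOpen_compl.mem_nhds hx] with y hy
        refine ⟨le_rfl, fun h => absurd h hy, fun hyM s hs hs' => ?_⟩
        obtain rfl := le_antisymm hs' hs
        simp [retr_eq_self hm hyM])
  -- The minimum over `u` and `-u` is an even step length and remains admissible.
  have hτm : ∀ u ∈ sphere J m, ∀ s, 0 ≤ s → s ≤ min (τ u) (τ (-u)) →
      ‖retr J m (u - s • w u) - u‖ ≤ 3 * s ∧ I (retr J m (u - s • w u)) ≤ I u - σ * s :=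
    fun u hu s hs hsτ => (hτ u).2.2 hu s hs (hsτ.trans (min_le_left _ _))
  have hτ0 : ∀ u, 0 ≤ min (τ u) (τ (-u)) := fun u => le_min (hτ u).1 (hτ (-u)).1
  have hτQ : ∀ u ∈ Q, 0 < min (τ u) (τ (-u)) := fun u hu =>
    lt_min ((hτ u).2.1 hu) ((hτ (-u)).2.1 (hQs u hu))
  refine ⟨fun s u => retr J m (u - (s * min (τ u) (τ (-u))) • w u), ?_, fun s u => ?_,
    fun s u hu => ?_, fun u hu => ?_, fun s hs u hu => ?_, fun u hu => ?_⟩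
  · refine continuousOn_retr.comp (f := fun p : ℝ × E =>
      p.2 - (p.1 * min (τ p.2) (τ (-p.2))) • w p.2) (by fun_prop) fun p hp => ?_
    exact (hm.trans_le (le_inner_sub_smul hp.2 (hwt _ hp.2) _)).ne'
  · simp only [neg_neg, hwo, ← retr_neg, min_comm (τ (-u))]
    congr 1
    module
  · exact retr_mem hm (hm.trans_le (le_inner_sub_smul hu (hwt _ hu) _))
  · simp [retr_eq_self hm hu]
  · obtain ⟨h1, h2⟩ := hτm u hu (s * min (τ u) (τ (-u))) (mul_nonneg hs.1 (hτ0 u))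
      (mul_le_of_le_one_left (hτ0 u) hs.2)
    refine h1.trans ?_
    rw [div_mul_eq_mul_div, le_div_iff₀ hσ]
    linarith
  · have h := (hτm u (hQM hu) (1 * min (τ u) (τ (-u))) (by simpa using hτ0 u) (by simp)).2
    have := mul_pos hσ (hτQ u hu)
    rw [one_mul] at h
    simp only [one_mul]
    linarith

end Step

/-! ### Iterating the descent -/

section Iteration

variable {E : Type*} [NormedAddCommGroup E] {M Q A : Set E} {I : E → ℝ} {C b : ℝ}

/-- The iterates of a descent step leave every region on which the descent is strict. -/
theorem exists_iterate_lt [CompleteSpace E] {f : E → E} (hM : IsClosed M) (hI : Continuous I)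
    (hb : BddBelow (I '' M)) (hC : 0 < C) (hf : ContinuousOn f M) (hfM : Set.MapsTo f M M)
    (hdec : ∀ u ∈ M, ‖f u - u‖ ≤ C * (I u - I (f u))) (hQ : ∀ u ∈ Q, I (f u) < I u)
    {u : E} (hu : u ∈ M) (huQ : ∀ v ∈ M, ‖v - u‖ ≤ C * (I u - I v) → b ≤ I v → v ∈ Q) :
    ∃ n : ℕ, I (f^[n] u) < b := by
  by_contra! hcon
  have hx : ∀ n, f^[n] u ∈ M := fun n => hfM.iterate n hu
  -- Displacements telescope against the decrease of `I`, which is bounded below, so the orbit will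
  -- be Cauchy.
  have hdist : ∀ n k, n ≤ k → dist (f^[n] u) (f^[k] u) ≤ C * (I (f^[n] u) - I (f^[k] u)) := by
    intro n k hnk
    induction k, hnk using Nat.le_induction with
    | base => simp
    | succ k _ ih =>
      have h1 := hdec _ (hx k)
      rw [← Function.iterate_succ_apply' f k u, ← dist_eq_norm, dist_comm] at h1
      linarith [dist_triangle (f^[n] u) (f^[k] u) (f^[k + 1] u)]
  have hanti : Antitone fun n => I (f^[n] u) := fun n k hnk => by
    have := nonneg_of_mul_nonneg_right (dist_nonneg.trans (hdist n k hnk)) hC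
    simpa using this
  have hbdd : BddBelow (Set.range fun n => I (f^[n] u)) :=
    hb.mono (Set.range_subset_iff.2 fun n => Set.mem_image_of_mem I (hx n))
  have hlim := tendsto_atTop_ciInf hanti hbdd
  have hcau : CauchySeq fun n => f^[n] u := by
    refine cauchySeq_of_le_tendsto_0' (fun n => C * (I (f^[n] u) - ⨅ k, I (f^[k] u)))
      (fun n k hnk => (hdist n k hnk).trans ?_) ?_
    · gcongr
      exact ciInf_le hbdd k
    · simpa using (hlim.sub_const (⨅ k, I (f^[k] u))).const_mul C
  obtain ⟨v, hv⟩ := cauchySeq_tendsto_of_complete hcau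
  have hvM : v ∈ M := hM.mem_of_tendsto hv (Eventually.of_forall hx)
  have hIv := (hI.tendsto v).comp hv
  have hfv : f v = v := by
    have h1 : Tendsto (fun n => f (f^[n] u)) atTop (𝓝 (f v)) :=
      (hf v hvM).tendsto.comp (tendsto_nhdsWithin_iff.2 ⟨hv, Eventually.of_forall hx⟩)
    have h2 := (tendsto_add_atTop_iff_nat 1).2 hv
    simp only [Function.iterate_succ_apply'] at h2
    exact tendsto_nhds_unique h1 h2
  have hvQ : v ∈ Q := by
    refine huQ v hvM ?_ (ge_of_tendsto' hIv hcon)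
    refine le_of_tendsto_of_tendsto' (hv.sub_const u).norm
      ((tendsto_const_nhds.sub hIv).const_mul C) fun n => ?_
    simpa [dist_eq_norm, norm_sub_rev] using hdist 0 n n.zero_le
  exact (hQ v hvQ).ne (by rw [hfv])

/-- An odd descent homotopy can be iterated to an odd deformation below the level `b`. -/
theorem exists_odd_deformation [NormedSpace ℝ E] [CompleteSpace E] {g : ℝ → E → E}
    (hM : IsClosed M) (hI : Continuous I)
    (hb : BddBelow (I '' M)) (hC : 0 < C)
    (hg : ContinuousOn (fun p : ℝ × E => g p.1 p.2) (Set.univ ×ˢ M))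
    (hgo : ∀ s u, g s (-u) = -g s u) (hgM : ∀ s, Set.MapsTo (g s) M M)
    (hg0 : ∀ u ∈ M, g 0 u = u)
    (hdec : ∀ s ∈ Set.Icc (0 : ℝ) 1, ∀ u ∈ M, ‖g s u - u‖ ≤ C * (I u - I (g s u)))
    (hQ : ∀ u ∈ Q, I (g 1 u) < I u) (hA : IsClosed A) (hAM : A ⊆ M)
    (hAQ : ∀ u ∈ A, ∀ v ∈ M, ‖v - u‖ ≤ C * (I u - I v) → b ≤ I v → v ∈ Q) :
    ∃ η : E → E, ContinuousOn η A ∧ (∀ u, η (-u) = -η u) ∧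
      Set.MapsTo η A (M ∩ {u | I u ≤ b}) := by
  have hg1 : ContinuousOn (g 1) M :=
    hg.comp (f := fun u => ((1 : ℝ), u)) (by fun_prop) fun u hu => ⟨trivial, hu⟩
  obtain ⟨N₀, hN₀⟩ := exists_continuous_forall_mem_convex_of_local_const
    (t := fun y : E => {r : ℝ | y ∈ A → ∃ n : ℕ, (n : ℝ) ≤ r ∧ I ((g 1)^[n] y) ≤ b})
    (fun y => by
      refine Set.OrdConnected.convex ⟨fun r hr r' _ z hz hy => ?_⟩
      obtain ⟨n, hn, hn'⟩ := hr hy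
      exact ⟨n, hn.trans hz.1, hn'⟩)
    (fun x => by
      by_cases hx : x ∈ A
      · obtain ⟨n, hn⟩ := exists_iterate_lt hM hI hb hC hg1 (hgM 1)
          (hdec 1 (by simp)) hQ (hAM hx) (hAQ x hx)
        have hc : ContinuousOn (fun y => I ((g 1)^[n] y)) M :=
          hI.comp_continuousOn (hg1.iterate (hgM 1) n)
        refine ⟨n, ?_⟩
        have hev := (hc x (hAM hx)).eventually_lt continuousWithinAt_const hn
        filter_upwards [eventually_nhdsWithin_iff.1 hev] with y hy hyA
        exact ⟨n, le_rfl, (hy (hAM hyA)).le⟩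
      · refine ⟨0, ?_⟩
        filter_upwards [hA.isOpen_compl.mem_nhds hx] with y hy hy'
        exact absurd hy' hy)
  set N : E → ℝ := fun u => max (N₀ u) (N₀ (-u)) with hN
  have hNc : Continuous N := by fun_prop
  have hNe : ∀ u, N (-u) = N u := fun u => by simp [hN, max_comm]
  -- Step `k` is full when `k + 1 ≤ N u`, void when `N u ≤ k`, and fractional in between.
  let r : ℕ → E → ℝ := fun k u => max 0 (min 1 (N u - k))
  have hrI : ∀ k u, r k u ∈ Set.Icc (0 : ℝ) 1 := fun k u =>
    ⟨le_max_left _ _, max_le zero_le_one (min_le_left _ _)⟩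
  let e : ℕ → E → E := fun k => Nat.rec id (fun k f u => g (r k u) (f u)) k
  have he : ∀ k u, e (k + 1) u = g (r k u) (e k u) := fun k u => rfl
  have heM : ∀ k, Set.MapsTo (e k) M M := by
    intro k
    induction k with
    | zero => exact Set.mapsTo_id M
    | succ k ih => exact fun u hu => hgM _ (ih hu)
  have hec : ∀ k, ContinuousOn (e k) M := by
    intro k
    induction k with
    | zero => exact continuousOn_id
    | succ k ih =>
      have hr : ContinuousOn (r k) M := by
        have : Continuous (r k) := by fun_prop
        exact this.continuousOn
      exact hg.comp (hr.prodMk ih) fun u hu => ⟨trivial, heM k hu⟩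
  have heo : ∀ k u, e k (-u) = -e k u := by
    intro k u
    induction k with
    | zero => rfl
    | succ k ih =>
      rw [he, he, ih, hgo]
      simp only [r, hNe]
  have hanti : ∀ u ∈ M, Antitone fun k => I (e k u) := fun u hu =>
    antitone_nat_of_succ_le fun k => by
      have h1 := hdec (r k u) (hrI k u) _ (heM k hu)
      have := nonneg_of_mul_nonneg_right ((norm_nonneg _).trans h1) hC
      rw [he]
      linarith
  have heit : ∀ (k : ℕ) u, (k : ℝ) ≤ N u → e k u = (g 1)^[k] u := by
    intro k u hk
    induction k with
    | zero => rfl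
    | succ k ih =>
      push_cast at hk
      have hr : r k u = 1 := by
        simp only [r]
        rw [min_eq_left (by linarith), max_eq_right zero_le_one]
      rw [he, hr, ih (by linarith), Function.iterate_succ_apply']
  have hest : ∀ u ∈ M, ∀ k, ⌈N u⌉₊ ≤ k → e k u = e ⌈N u⌉₊ u := by
    intro u hu k hk
    induction k, hk using Nat.le_induction with
    | base => rfl
    | succ k hk ih =>
      have hr : r k u = 0 := by
        have := Nat.ceil_le.1 hk
        simp only [r]
        rw [min_eq_right (by linarith), max_eq_left (by linarith)]
      rw [he, hr, hg0 _ (heM k hu), ih]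
  refine ⟨fun u => e ⌈N u⌉₊ u, fun u hu => ?_, fun u => ?_, fun u hu => ⟨heM _ (hAM hu), ?_⟩⟩
  -- The ceiling jumps, but the sequence `e k u` is constant beyond it, so locally the map equals a
  -- single `e k`.
  · obtain ⟨k, hk⟩ := exists_nat_gt (N u)
    have hev : ∀ᶠ y in 𝓝[A] u, N y < k :=
      eventually_nhdsWithin_of_eventually_nhds
        (hNc.continuousAt.eventually_lt continuousAt_const hk)
    refine (((hec k).mono hAM) u hu).congr_of_eventuallyEq ?_
      (hest u (hAM hu) k (Nat.ceil_le.2 hk.le)).symm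
    filter_upwards [hev, self_mem_nhdsWithin] with y hy hyA
    exact (hest y (hAM hyA) k (Nat.ceil_le.2 hy.le)).symm
  · simp only [hNe, heo]
  · obtain ⟨n, hn, hnb⟩ := hN₀ u hu
    have hnN : (n : ℝ) ≤ N u := hn.trans (le_max_left _ _)
    have hle : n ≤ ⌈N u⌉₊ := by exact_mod_cast hnN.trans (Nat.le_ceil _)
    have := hanti u (hAM hu) hle
    simp only [heit n u hnN] at this
    exact this.trans hnb

end Iteration

/-! ### Genus of sublevels and minimax values -/

section Minimax

variable {E H : Type*} [NormedAddCommGroup E] [NormedSpace ℝ E]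
  [NormedAddCommGroup H] [InnerProductSpace ℝ H] {J : E →L[ℝ] H} {m : ℝ} {I : E → ℝ}

/-- Crossing a level at which the Palais-Smale condition holds changes the genus of the sublevels
at most by the genus of the critical set. -/
theorem exists_sublevel_genus [CompleteSpace E] (hm : 0 < m) (hI : ContDiff ℝ 1 I)
    (hE : Function.Even I)
    (hb : BddBelow (I '' sphere J m)) {c : ℝ} (hPS : PalaisSmale J m I c) {q : ℕ}
    (hq : HasOddMap (criticalSet J m I c) q) :
    ∃ ε > 0, ∀ j : ℕ, ¬ HasOddMap (sphere J m ∩ {u | I u ≤ c + ε}) (j + q) →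
      ¬ HasOddMap (sphere J m ∩ {u | I u ≤ c - ε}) j := by
  have hKs : ∀ u ∈ criticalSet J m I c, -u ∈ criticalSet J m I c :=
    fun u hu => neg_mem_criticalSet hE hu
  obtain ⟨δ, hδ, hq⟩ := hq.exists_cthickening (isCompact_criticalSet hm hI hPS) hKs
  set K := criticalSet J m I c
  have hts : ∀ (r : ℝ) (u : E), -u ∈ Metric.thickening r K → u ∈ Metric.thickening r K := by
    intro r u hu
    obtain ⟨z, hz, hd⟩ := Metric.mem_thickening_iff.1 hu
    exact Metric.mem_thickening_iff.2 ⟨-z, hKs z hz, by rwa [← dist_neg_neg, neg_neg]⟩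
  obtain ⟨σ, hσ, hσd⟩ := hPS.exists_lt_derivNorm hm hI
    (Metric.isOpen_thickening (δ := δ / 2) (E := K))
    (Metric.self_subset_thickening (half_pos hδ) K)
  -- Between the levels `c + ε` and `c - ε` a point moves at most `(3 / σ) * 2ε ≤ δ / 4`, so an
  -- orbit starting outside the `δ`-neighbourhood of `K` cannot enter the `δ / 2`-neighbourhood.
  set ε := min σ (σ * δ / 24) with hε
  have hε0 : 0 < ε := by positivity
  have hεσ : ε ≤ σ := min_le_left _ _
  have hεδ : ε ≤ σ * δ / 24 := min_le_right _ _
  refine ⟨ε, hε0, fun j hj hj' => hj ?_⟩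
  have hIc := hI.continuous
  set Q : Set E := sphere J m ∩ {u | |I u - c| ≤ ε} ∩ (Metric.thickening (δ / 2) K)ᶜ
  set A : Set E := sphere J m ∩ {u | I u ≤ c + ε} ∩ (Metric.thickening δ K)ᶜ
  have hA : IsClosed A :=
    (isClosed_sphere.inter (isClosed_le hIc continuous_const)).inter
      Metric.isOpen_thickening.isClosed_compl
  have hAs : ∀ u ∈ A, -u ∈ A := fun u hu =>
    ⟨⟨neg_mem_sphere hu.1.1, (hE u).le.trans hu.1.2⟩, fun h => hu.2 (hts _ _ h)⟩
  have hQ : IsClosed Q :=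
    (isClosed_sphere.inter (isClosed_le (by fun_prop) continuous_const)).inter
      Metric.isOpen_thickening.isClosed_compl
  have hQs : ∀ u ∈ Q, -u ∈ Q := fun u hu =>
    ⟨⟨neg_mem_sphere hu.1.1, by simpa [hE u] using hu.1.2⟩, fun h => hu.2 (hts _ _ h)⟩
  obtain ⟨g, hg, hgo, hgM, hg0, hdec, hgQ⟩ := exists_descent_step hm hI hE hQ
    (fun u hu => hu.1.1) hQs hσ fun u hu => hσd u hu.1.1 (le_trans hu.1.2 hεσ) hu.2
  obtain ⟨η, hη, hηo, hηM⟩ := exists_odd_deformation (b := c - ε) isClosed_sphere hIc hb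
    (by positivity : 0 < 3 / σ) hg hgo hgM hg0 hdec hgQ hA (fun u hu => hu.1.1) (by
      intro u hu v hv hvu hbv
      have h0 := nonneg_of_mul_nonneg_right ((norm_nonneg _).trans hvu) (by positivity : 0 < 3 / σ)
      have hIu : I u ≤ c + ε := hu.1.2
      have hIv : |I v - c| ≤ ε := abs_le.2 ⟨by linarith, by linarith⟩
      refine ⟨⟨hv, hIv⟩, fun hvK => hu.2 ?_⟩
      obtain ⟨z, hz, hdz⟩ := Metric.mem_thickening_iff.1 hvK
      refine Metric.mem_thickening_iff.2 ⟨z, hz, ?_⟩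
      have h1 : ‖v - u‖ ≤ δ / 4 := by
        refine hvu.trans ?_
        rw [div_mul_eq_mul_div, div_le_iff₀ hσ]
        linarith
      rw [← dist_eq_norm, dist_comm] at h1
      linarith [dist_triangle u v z])
  have hAj : HasOddMap A j := hj'.comp hη (fun u _ => hηo u) hηM
  refine (hAj.union hA hAs Metric.isClosed_cthickening
    (fun u hu => neg_mem_cthickening hKs hu) hq).mono_set fun u hu => ?_
  by_cases huK : u ∈ Metric.thickening δ K
  · exact Or.inr (Metric.thickening_subset_cthickening _ _ huK)
  · exact Or.inl ⟨hu, huK⟩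

/-- A compact symmetric set which does not contain zero has finite genus. -/
theorem exists_hasOddMap_of_isCompact (hJ : Function.Injective J) {K : Set E} (hK : IsCompact K)
    (h0 : 0 ∉ K) : ∃ q, HasOddMap K q := by
  -- The functions `u ↦ (x, u)_H` are odd and continuous; finitely many of them have no common zero
  -- on `K`.
  obtain ⟨t, ht⟩ := hK.elim_finite_subcover (fun x : E => {u | inner ℝ (J x) (J u) ≠ 0})
    (fun x => isOpen_ne_fun (by fun_prop) continuous_const) fun u hu => by
      refine Set.mem_iUnion.2 ⟨u, ?_⟩
      have hne : J u ≠ 0 := fun h => h0 (by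
        rw [← map_zero J] at h
        exact hJ h ▸ hu)
      exact inner_self_ne_zero.2 hne
  refine ⟨_, HasOddMap.of_finrank (V := t → ℝ) rfl
    (φ := fun u x => inner ℝ (J x) (J u)) (by fun_prop) (fun u _ => ?_) fun u hu h => ?_⟩
  · ext x
    simp
  · obtain ⟨x, hx, hxu⟩ := Set.mem_iUnion₂.1 (ht hu)
    exact hxu (congrFun h ⟨x, hx⟩)

/-- A sublevel contains every competitor on which `I ≤ r`, so the infimum over `Γ_{j+1}` can be
tested on sublevels alone. -/
theorem sublevel_mem_Gam (hI : Continuous I) (hE : Function.Even I) {j : ℕ} {r : ℝ}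
    (h : ¬ HasOddMap (sphere J m ∩ {u | I u ≤ r}) j) :
    sphere J m ∩ {u | I u ≤ r} ∈ Gam J m (j + 1) :=
  ⟨⟨Set.inter_subset_left, isClosed_sphere.inter (isClosed_le hI continuous_const),
    fun u hu => ⟨neg_mem_sphere hu.1, (hE u).le.trans hu.2⟩⟩, succ_le_genus_iff.2 h⟩

theorem minimax_le_of_not_hasOddMap (hI : Continuous I) (hE : Function.Even I) {j : ℕ} {r : ℝ}
    (h : ¬ HasOddMap (sphere J m ∩ {u | I u ≤ r}) j) : minimax J m I (j + 1) ≤ r :=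
  iInf₂_le_of_le _ (sublevel_mem_Gam hI hE h) (iSup₂_le fun _ hu => EReal.coe_le_coe_iff.2 hu.2)

theorem not_hasOddMap_of_minimax_lt {j : ℕ} {r : ℝ} (h : minimax J m I (j + 1) < r) :
    ¬ HasOddMap (sphere J m ∩ {u | I u ≤ r}) j := by
  obtain ⟨A, h⟩ := iInf_lt_iff.1 h
  obtain ⟨hA, h⟩ := iInf_lt_iff.1 h
  intro hj
  refine succ_le_genus_iff.1 hA.2 (hj.mono_set fun u hu => ⟨hA.1.1 hu, ?_⟩)
  exact EReal.coe_le_coe_iff.1 ((le_iSup₂ (f := fun u (_ : u ∈ A) => (I u : EReal)) u hu).trans h.le)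

theorem minimax_mono {j k : ℕ} (hjk : j ≤ k) : minimax J m I j ≤ minimax J m I k :=
  biInf_mono fun _ hA => ⟨hA.1, le_trans (by exact_mod_cast hjk) hA.2⟩

theorem le_minimax {k : ℕ} {r : ℝ} (hr : ∀ u ∈ sphere J m, r ≤ I u) :
    (r : EReal) ≤ minimax J m I (k + 1) := by
  refine le_iInf₂ fun A hA => ?_
  obtain ⟨u, hu⟩ : A.Nonempty := Set.nonempty_iff_ne_empty.2 fun h =>
    succ_le_genus_iff.1 hA.2 ((hasOddMap_zero_iff.2 h).mono k.zero_le)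
  exact (EReal.coe_le_coe_iff.2 (hr u (hA.1.1 hu))).trans
    (le_iSup₂ (f := fun u (_ : u ∈ A) => (I u : EReal)) u hu)

/-- If there are symmetric sets of arbitrarily large genus, then there are such sets on which `I`
is bounded above. -/
theorem exists_minimax_le (hI : Continuous I) (hE : Function.Even I)
    (hGam : ∀ k : ℕ, 1 ≤ k → (Gam J m k).Nonempty) (k : ℕ) :
    ∃ r : ℝ, minimax J m I (k + 1) ≤ r := by
  by_contra! hcon
  -- Were all sublevels to have genus at most `k`, the sphere would have genus at most `k + k`.
  obtain ⟨A, hA⟩ := hGam (k + k + 1) (by omega)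
  refine succ_le_genus_iff.1 hA.2 ((HasOddMap.of_sublevels isClosed_sphere
    (fun u hu => neg_mem_sphere hu) hI hE fun r => ?_).mono_set hA.1.1)
  by_contra h
  exact (hcon r).not_ge (minimax_le_of_not_hasOddMap hI hE h)

end Minimax

end ConstrainedMinimax

/-! ### The main theorem -/

theorem theorem2p1 {E H : Type*}
    [NormedAddCommGroup E] [NormedSpace ℝ E] [CompleteSpace E]
    [NormedAddCommGroup H] [InnerProductSpace ℝ H] [CompleteSpace H]
    (J : E →L[ℝ] H) (hJ : Function.Injective J)
    (m : ℝ) (hm : 0 < m)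
    (I : E → ℝ) (hI : ContDiff ℝ 1 I) (hEven : Function.Even I)
    (hBdd : BddBelow (I '' ConstrainedMinimax.sphere J m))
    (hPS : ∀ c : ℝ, c < 0 → ConstrainedMinimax.PalaisSmale J m I c)
    (hGam : ∀ k : ℕ, 1 ≤ k → (ConstrainedMinimax.Gam J m k).Nonempty) :
    ∃ c : ℕ → ℝ,
      -- the minimax values are finite and nondecreasing
      (∀ k : ℕ, 1 ≤ k → (c k : EReal) = ConstrainedMinimax.minimax J m I k) ∧
      (∀ k : ℕ, 1 ≤ k → c k ≤ c (k + 1)) ∧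
      -- (i)
      (∀ k : ℕ, 1 ≤ k → c k < 0 → ConstrainedMinimax.IsCriticalValue J m I (c k)) ∧
      -- (ii)
      (∀ k l : ℕ, 1 ≤ k → 1 ≤ l → ∀ a : ℝ, a < 0 → (∀ j : ℕ, j < l → c (k + j) = a) →
        (l : ℕ∞) ≤ ConstrainedMinimax.genus (ConstrainedMinimax.criticalSet J m I a) ∧
        (2 ≤ l → (ConstrainedMinimax.criticalSet J m I a).Infinite)) ∧
      -- (iii)
      ((∀ k : ℕ, 1 ≤ k → c k < 0) → Tendsto c atTop (𝓝[<] 0)) := by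
  open ConstrainedMinimax in
  have hIc := hI.continuous
  obtain ⟨r₀, hr₀⟩ := hBdd
  have hlow : ∀ u ∈ sphere J m, r₀ ≤ I u := fun u hu => hr₀ (Set.mem_image_of_mem I hu)
  have hreal : ∀ k : ℕ, ((minimax J m I (k + 1)).toReal : EReal) = minimax J m I (k + 1) := by
    intro k
    obtain ⟨r, hr⟩ := exists_minimax_le hIc hEven hGam k
    exact EReal.coe_toReal (hr.trans_lt (EReal.coe_lt_top r)).ne
      ((EReal.bot_lt_coe r₀).trans_le (le_minimax hlow)).ne'
  -- The entry `c 0` carries no information, since `∅` belongs to `Γ_0`.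
  set c : ℕ → ℝ := fun k => (minimax J m I k).toReal with hc
  have hcr : ∀ k, 1 ≤ k → (c k : EReal) = minimax J m I k := by
    intro k hk
    obtain ⟨j, rfl⟩ := Nat.exists_eq_add_of_le' hk
    exact hreal j
  have hmono : ∀ j k, 1 ≤ j → j ≤ k → c j ≤ c k := fun j k hj hjk => by
    rw [← EReal.coe_le_coe_iff, hcr j hj, hcr k (hj.trans hjk)]
    exact minimax_mono hjk
  have hle : ∀ (j : ℕ) (r : ℝ), ¬ HasOddMap (sphere J m ∩ {u | I u ≤ r}) j → c (j + 1) ≤ r :=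
    fun j r h => by
      rw [← EReal.coe_le_coe_iff, hcr _ (by omega)]
      exact minimax_le_of_not_hasOddMap hIc hEven h
  have hlt : ∀ (j : ℕ) (r : ℝ), c (j + 1) < r → ¬ HasOddMap (sphere J m ∩ {u | I u ≤ r}) j :=
    fun j r h => not_hasOddMap_of_minimax_lt (by
      rw [← hcr _ (by omega)]
      exact EReal.coe_lt_coe_iff.2 h)
  have hstep : ∀ a : ℝ, a < 0 → ∀ q, HasOddMap (criticalSet J m I a) q → ∃ ε > 0, ∀ j : ℕ,
      c (j + q + 1) ≤ a → c (j + 1) ≤ a - ε := by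
    intro a ha q hq
    obtain ⟨ε, hε, h⟩ := exists_sublevel_genus hm hI hEven ⟨r₀, hr₀⟩ (hPS a ha) hq
    exact ⟨ε, hε, fun j hj => hle _ _ (h j (hlt _ _ (by linarith)))⟩
  have hii : ∀ k l : ℕ, 1 ≤ k → 1 ≤ l → ∀ a : ℝ, a < 0 → (∀ j : ℕ, j < l → c (k + j) = a) →
      (l : ℕ∞) ≤ genus (criticalSet J m I a) := by
    intro k l hk hl a ha hka
    obtain ⟨k, rfl⟩ := Nat.exists_eq_add_of_le' hk
    obtain ⟨l, rfl⟩ := Nat.exists_eq_add_of_le' hl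
    refine succ_le_genus_iff.2 fun hq => ?_
    obtain ⟨ε, hε, h⟩ := hstep a ha l hq
    have h1 := hka l (by omega)
    have h2 := hka 0 (by omega)
    rw [add_right_comm] at h1
    have h3 := h k h1.le
    rw [add_zero] at h2
    linarith
  refine ⟨c, hcr, fun k hk => hmono k (k + 1) hk (by omega), fun k hk hk0 => ?_,
    fun k l hk hl a ha hka => ⟨hii k l hk hl a ha hka, fun hl2 hfin => ?_⟩, fun hneg => ?_⟩
  · have h := hii k 1 hk le_rfl (c k) hk0 fun j hj => by rw [Nat.lt_one_iff.1 hj, add_zero]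
    rw [← zero_add 1, succ_le_genus_iff, hasOddMap_zero_iff] at h
    exact Set.nonempty_iff_ne_empty.2 h
  · have h1 := hasOddMap_one_of_finite hfin fun h0 => zero_notMem_sphere hm h0.1.1
    have h2 := (hii k l hk hl a ha hka).trans (genus_le_iff.2 h1)
    have : l ≤ 1 := by exact_mod_cast h2
    omega
  · have hmono' : Monotone fun k => c (k + 1) := fun j k hjk =>
      hmono _ _ (by omega) (by omega)
    have hbd : BddAbove (Set.range fun k => c (k + 1)) :=
      ⟨0, by rintro _ ⟨k, rfl⟩; exact (hneg _ (by omega)).le⟩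
    have hlim := tendsto_atTop_ciSup hmono' hbd
    set a := ⨆ k, c (k + 1) with ha
    have hca : ∀ k, c (k + 1) ≤ a := fun k => le_ciSup hbd k
    have ha0 : a = 0 := by
      -- If `a < 0`, the drop `ε` at level `a` applies to every `c (k + 1)`, since `c (k + q + 1) ≤
      -- a` always holds.
      refine le_antisymm (ciSup_le fun k => (hneg _ (by omega)).le) ?_
      by_contra! hlt0
      obtain ⟨q, hq⟩ := exists_hasOddMap_of_isCompact hJ
        (isCompact_criticalSet hm hI (hPS a hlt0)) fun h0 => zero_notMem_sphere hm h0.1.1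
      obtain ⟨ε, hε, h⟩ := hstep a hlt0 q hq
      have : a ≤ a - ε := ciSup_le fun k => h k (hca _)
      linarith
    rw [ha0] at hlim
    refine tendsto_nhdsWithin_iff.2 ⟨(tendsto_add_atTop_iff_nat 1).1 hlim, ?_⟩
    filter_upwards [eventually_ge_atTop 1] with k hk
    exact hneg k hk
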